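/- Let $V,D,K\ge 1$ be the numbers of terms, documents and topics, let $X=(x_{vd})\in\mathbb N_0^{V\times D}$ be a term-document count matrix with columns $x_d$, let $\alpha\in\mathbb R_{>0}^K$ and $a>0$ be fixed, and let $W\in\Delta_{V-1}^K$ denote a normalized topic matrix, i.e. a $V\times K$ matrix whose columns lie in the standard simplex $\Delta_{V-1}=\{y\in\mathbb R_{\ge0}^V:\sum_v y_v=1\}$. Documents are independent. Consider three models: * Gamma–Poisson: $h_{kd}\sim\Gamma(\alpha_k,a)$ independent (shape $\alpha_k$, common rate $a$), $z_{vkd}\sim\mathrm{Poisson}(w_{vk}h_{kd})$ independent given $h_d$, and $X_{vd}=\sum_k z_{vkd}$; its marginal likelihood is $L^{\mathrm{GaP}}(W)=p(X\mid W,\alpha,a)$. * Dirichlet–Poisson: the same, but with $h_d\sim\mathrm{Dirichlet}(\alpha)$; its marginal likelihood is $L^{\mathrm{DP}}(W)=p(X\mid W,\alpha)$. * Latent Dirichlet allocation (LDA): $h_d\sim\mathrm{Dirichlet}(\alpha)$ and, independently for each of the $N_d=\sum_v x_{vd}$ words of document $d$, a topic $z_{nd}$ with $p(z_{nd}=k)=h_{kd}$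 and a word $\nu_{nd}$ with $p(\nu_{nd}=v\mid z_{nd}=k)=w_{vk}$. Let $L^{\mathrm{LDA}}(W)=\prod_d\int p(h\mid\alpha)\prod_v (Wh)_v^{x_{vd}}\,dh$ be the marginal likelihood of any corpus of words with term counts $X$. Then all three likelihoods are finite and there are constants $c=c(X,\sum_k\alpha_k,a)>0$ and $c'=c'(X,\sum_k\alpha_k,a)>0$, depending only on $X$, $\sum_k\alpha_k$ and $a$, such that for all $W\in\Delta_{V-1}^K$ $$L^{\mathrm{GaP}}(W)=c\,L^{\mathrm{DP}}(W)=c'\,L^{\mathrm{LDA}}(W).$$ Consequently $L^{\mathrm{GaP}}$, $L^{\mathrm{DP}}$ and $L^{\mathrm{LDA}}$ have the same maximizers $W$ over $\Delta_{V-1}^K$. -/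

import Mathlib

open MeasureTheory ProbabilityTheory
open scoped ENNReal

noncomputable section

namespace TopicModel

/-- The point `(y₁, …, yₘ, 1 - ∑ yᵢ)` of the hyperplane `∑ hₖ = 1` in `ℝ^(m+1)`. -/
def simplexChart {m : ℕ} (y : Fin m → ℝ) : Fin (m + 1) → ℝ :=
  Fin.snoc (α := fun _ => ℝ) y (1 - ∑ i, y i)

theorem measurable_simplexChart {m : ℕ} : Measurable (simplexChart (m := m)) := by
  rw [measurable_pi_iff]
  intro k
  refine Fin.lastCases ?_ (fun i => ?_) k
  · simp only [simplexChart, Fin.snoc_last]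
    fun_prop
  · simp only [simplexChart, Fin.snoc_castSucc]
    fun_prop

open Classical in
/-- Density of the Dirichlet distribution at `h`: zero off the open positive orthant. -/
def dirichletPDFReal {m : ℕ} (α : Fin (m + 1) → ℝ) (h : Fin (m + 1) → ℝ) : ℝ :=
  if ∀ k, 0 < h k then
    Real.Gamma (∑ k, α k) / (∏ k, Real.Gamma (α k)) * ∏ k, h k ^ (α k - 1)
  else 0

/-- The Dirichlet distribution `Dir(α)` on the simplex in `ℝ^(m+1)`: it has the Dirichlet density
with respect to Lebesgue measure in the first `m` coordinates. -/
def dirichletMeasure {m : ℕ} (α : Fin (m + 1) → ℝ) : Measure (Fin (m + 1) → ℝ) :=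
  ((volume : Measure (Fin m → ℝ)).withDensity
    fun y => ENNReal.ofReal (dirichletPDFReal α (simplexChart y))).map simplexChart

/-- Independent topic weights `hₖ ∼ Γ(αₖ, aₖ)` (shape `αₖ`, rate `aₖ`). -/
def gammaPrior {K : Type*} [Fintype K] (α a : K → ℝ) : Measure (K → ℝ) :=
  Measure.pi fun k => gammaMeasure (α k) (a k)

/-- Conditional law, given the weights `h`, of the counts `X_v = ∑ₖ z_vk` of a document, where
`z_vk ∼ Poisson(w_vk hₖ)` independently. -/
def poissonCountLaw {V K : Type*} [Fintype V] [Fintype K] (W : Matrix V K ℝ) (h : K → ℝ) :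
    Measure (V → ℕ) :=
  (Measure.pi fun v => Measure.pi fun k => poissonMeasure (W v k * h k).toNNReal).map
    fun z v => ∑ k, z v k

/-- Conditional probability, given the topic proportions `h`, of the words `ν₁, …, ν_N` of a
document, where `zₙ ∼ Cat(h)` and `νₙ ∼ Cat(w_{zₙ})` independently for each `n`. -/
def ldaWordProb {V K : Type*} [Fintype K] {N : ℕ} (W : Matrix V K ℝ) (h : K → ℝ)
    (ν : Fin N → V) : ℝ :=
  ∑ z : Fin N → K, ∏ n, h (z n) * W (ν n) (z n)

section Likelihoods

variable {V D : Type*} [Fintype V] [Fintype D]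

/-- Marginal likelihood `p(X | W, α, a)` of the Gamma–Poisson model. -/
def gammaPoissonLikelihood {K : Type*} [Fintype K] (X : Matrix V D ℕ) (α a : K → ℝ)
    (W : Matrix V K ℝ) : ℝ≥0∞ :=
  ∏ d, ∫⁻ h, poissonCountLaw W h {fun v => X v d} ∂(gammaPrior α a)

/-- Marginal likelihood `p(X | W, α)` of the Dirichlet–Poisson model. -/
def dirichletPoissonLikelihood {m : ℕ} (X : Matrix V D ℕ) (α : Fin (m + 1) → ℝ)
    (W : Matrix V (Fin (m + 1)) ℝ) : ℝ≥0∞ :=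
  ∏ d, ∫⁻ h, poissonCountLaw W h {fun v => X v d} ∂(dirichletMeasure α)

/-- Marginal likelihood, under latent Dirichlet allocation, of a corpus in which document `d`
consists of the words `ν d 0, ν d 1, …`. -/
def ldaLikelihood {V D : Type*} [Fintype D] {m : ℕ} {N : D → ℕ} (ν : ∀ d, Fin (N d) → V)
    (α : Fin (m + 1) → ℝ) (W : Matrix V (Fin (m + 1)) ℝ) : ℝ≥0∞ :=
  ∏ d, ∫⁻ h, ENNReal.ofReal (ldaWordProb W h (ν d)) ∂(dirichletMeasure α)

open Classical in
/-- The term-document matrix of a corpus: entry `(v, d)` is the number of occurrences of the term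
`v` in document `d`. -/
def termCounts {V D : Type*} {N : D → ℕ} (ν : ∀ d, Fin (N d) → V) : Matrix V D ℕ :=
  fun v d => (Finset.univ.filter fun n => ν d n = v).card

/-- Normalized topic matrices: every column lies in the standard simplex. -/
def normalizedTopics (V K : Type*) [Fintype V] : Set (Matrix V K ℝ) :=
  {W | ∀ k, (fun v => W v k) ∈ stdSimplex ℝ V}

/-- The optimal normalized topic matrices for a likelihood `L`. -/
def optimalTopics {K : Type*} (L : Matrix V K ℝ → ℝ≥0∞) : Set (Matrix V K ℝ) :=
  {W | W ∈ normalizedTopics V K ∧ IsMaxOn L (normalizedTopics V K) W}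

end Likelihoods

end TopicModel

end

/-! For one document with counts `x` and `n = ∑ x_v`, put `F(h) = ∏ (Wh)_v ^ x_v`, a form of degree
`n` and the only carrier of `W`. Since the columns of `W` sum to one, the total Poisson rate is `∑
h_k`, so the conditional law of the counts is `exp(-∑ h_k) F(h) / ∏ x_v!`
(`poissonCountLaw_singleton`); for LDA it is `F(h)` itself (`ldaWordProb_eq_prod_pow_termCounts`).

All three likelihoods thus reduce to the Dirichlet integral of `F`. Under the Dirichlet prior the
exponential is the constant `e⁻¹`. Under the gamma prior, write `h = r • u` with `u` in the simplex:
the common rate makes the density split into a Dirichlet part in `u` and a radial part, to which `F`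
adds `r ^ n`, so the radial integral depends only on `∑ α_k`, `a` and `n`
(`lintegral_gammaPrior_eq`). Positive finite factors preserve maximizers and transfer finiteness
from the Gamma–Poisson case. -/

namespace TopicModel

/-! ### Radial coordinates and product densities -/

section Lebesgue

theorem lintegral_eq_pow_mul_lintegral_smul {m : ℕ} {g : (Fin m → ℝ) → ℝ≥0∞} (hg : Measurable g)
    {r : ℝ} (hr : 0 < r) :
    ∫⁻ y, g y = ENNReal.ofReal (r ^ m) * ∫⁻ y, g (r • y) := by
  have h := Measure.map_addHaar_smul (volume : Measure (Fin m → ℝ)) hr.ne'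
  rw [← lintegral_map hg (measurable_const_smul r), h, lintegral_smul_measure, smul_eq_mul,
    ← mul_assoc, ← ENNReal.ofReal_mul (by positivity)]
  have hpos : 0 < r ^ m := pow_pos hr m
  simp [abs_of_pos hpos, hpos.ne']

theorem measurable_snoc {m : ℕ} :
    Measurable fun p : ℝ × (Fin m → ℝ) =>
      (Fin.snoc (α := fun _ => ℝ) p.2 p.1 : Fin (m + 1) → ℝ) := by
  rw [measurable_pi_iff]
  intro k
  refine Fin.lastCases ?_ (fun i => ?_) k
  · simp only [Fin.snoc_last]
    fun_prop
  · simp only [Fin.snoc_castSucc]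
    fun_prop

theorem lintegral_eq_lintegral_snoc {m : ℕ} {G : (Fin (m + 1) → ℝ) → ℝ≥0∞} (hG : Measurable G) :
    ∫⁻ h, G h = ∫⁻ y : Fin m → ℝ, ∫⁻ t : ℝ, G (Fin.snoc (α := fun _ => ℝ) y t) := by
  have h := (volume_preserving_piFinSuccAbove (fun _ : Fin (m + 1) => ℝ) (Fin.last m)).symm
  rw [← h.lintegral_comp hG]
  have heq : ∀ p : ℝ × (Fin m → ℝ),
      (MeasurableEquiv.piFinSuccAbove (fun _ : Fin (m + 1) => ℝ) (Fin.last m)).symm p =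
        Fin.snoc (α := fun _ => ℝ) p.2 p.1 := by
    intro p
    exact Fin.insertNth_last' _ _
  simp_rw [heq]
  exact lintegral_prod_symm' (μ := (volume : Measure ℝ)) (ν := (volume : Measure (Fin m → ℝ)))
    (fun p => G (Fin.snoc (α := fun _ => ℝ) p.2 p.1)) (hG.comp measurable_snoc)

theorem sum_simplexChart {m : ℕ} (y : Fin m → ℝ) : ∑ k, simplexChart y k = 1 := by
  simp [simplexChart, Fin.sum_univ_castSucc]

theorem snoc_smul_eq_smul_simplexChart {m : ℕ} (r : ℝ) (y : Fin m → ℝ) :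
    (Fin.snoc (α := fun _ => ℝ) (r • y) (r - ∑ i, (r • y) i) : Fin (m + 1) → ℝ) =
      r • simplexChart y := by
  ext k
  refine Fin.lastCases ?_ (fun i => ?_) k
  · simp [simplexChart, mul_sub, Finset.mul_sum]
  · simp [simplexChart]

/-- Integration over the positive orthant in the coordinates `h = r • simplexChart y`. -/
theorem lintegral_eq_lintegral_smul_simplexChart {m : ℕ} {G : (Fin (m + 1) → ℝ) → ℝ≥0∞}
    (hG : Measurable G) (hG0 : ∀ h, (¬ ∀ k, 0 < h k) → G h = 0) :
    ∫⁻ h, G h = ∫⁻ r in Set.Ioi (0 : ℝ),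
      ENNReal.ofReal (r ^ m) * ∫⁻ y, G (r • simplexChart y) := by
  have hmeas : Measurable fun p : (Fin m → ℝ) × ℝ =>
      G (Fin.snoc (α := fun _ => ℝ) p.1 (p.2 - ∑ i, p.1 i)) := by
    have : Measurable fun p : (Fin m → ℝ) × ℝ => ((p.2 - ∑ i, p.1 i, p.1) : ℝ × (Fin m → ℝ)) := by
      fun_prop
    exact hG.comp (measurable_snoc.comp this)
  have hmeas_left : ∀ r : ℝ, Measurable fun y : Fin m → ℝ =>
      G (Fin.snoc (α := fun _ => ℝ) y (r - ∑ i, y i)) := fun r =>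
    hmeas.comp (measurable_id.prodMk measurable_const)
  rw [lintegral_eq_lintegral_snoc hG]
  -- Translating the last coordinate makes the outer variable the total `r` of all coordinates;
  -- scaling `y` by `r` then yields the Jacobian `r ^ m`.
  have hshift : ∀ y : Fin m → ℝ, ∫⁻ t : ℝ, G (Fin.snoc (α := fun _ => ℝ) y t) =
      ∫⁻ t : ℝ, G (Fin.snoc (α := fun _ => ℝ) y (t - ∑ i, y i)) := fun y =>
    (lintegral_sub_right_eq_self (fun t : ℝ => G (Fin.snoc (α := fun _ => ℝ) y t)) (∑ i, y i)).symm
  simp_rw [hshift]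
  rw [lintegral_lintegral_swap hmeas.aemeasurable, ← lintegral_indicator measurableSet_Ioi]
  refine lintegral_congr fun r => ?_
  by_cases hr : 0 < r
  · rw [Set.indicator_of_mem (Set.mem_Ioi.2 hr), lintegral_eq_pow_mul_lintegral_smul
      (hmeas_left r) hr]
    simp only [snoc_smul_eq_smul_simplexChart]
  -- A point with total `r ≤ 0` cannot have all coordinates positive.
  · rw [Set.indicator_of_notMem (by simpa using hr)]
    rw [lintegral_eq_zero_iff (hmeas_left r)]
    refine Filter.Eventually.of_forall fun y => hG0 _ fun hpos => hr ?_
    have h := Finset.sum_pos (fun k _ => hpos k) Finset.univ_nonempty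
    simpa [Fin.sum_univ_castSucc] using h

theorem lintegral_fin_prod_eq_prod {n : ℕ} {f : Fin n → ℝ → ℝ≥0∞} (hf : ∀ i, Measurable (f i)) :
    ∫⁻ x : Fin n → ℝ, ∏ i, f i (x i) = ∏ i, ∫⁻ t, f i t := by
  induction n with
  | zero => simp [volume_pi]
  | succ n ih =>
    rw [lintegral_eq_lintegral_snoc (by fun_prop)]
    simp_rw [Fin.prod_univ_castSucc, Fin.snoc_castSucc, Fin.snoc_last]
    simp_rw [lintegral_const_mul _ (hf (Fin.last n))]
    rw [lintegral_mul_const _ (by fun_prop), ih fun i => hf (Fin.castSucc i)]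

theorem pi_withDensity {n : ℕ} {f : Fin n → ℝ → ℝ≥0∞} (hf : ∀ i, Measurable (f i))
    [∀ i, SigmaFinite ((volume : Measure ℝ).withDensity (f i))] :
    Measure.pi (fun i => (volume : Measure ℝ).withDensity (f i)) =
      (volume : Measure (Fin n → ℝ)).withDensity fun x => ∏ i, f i (x i) := by
  refine Measure.pi_eq fun s hs => ?_
  rw [withDensity_apply _ (MeasurableSet.univ_pi hs),
    ← lintegral_indicator (MeasurableSet.univ_pi hs)]
  have : ∀ x : Fin n → ℝ, (Set.univ.pi s).indicator (fun x => ∏ i, f i (x i)) x =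
      ∏ i, (s i).indicator (f i) (x i) := by
    intro x
    by_cases hx : x ∈ Set.univ.pi s
    · rw [Set.indicator_of_mem hx]
      exact Finset.prod_congr rfl fun i _ =>
        (Set.indicator_of_mem (hx i (Set.mem_univ i)) (f i)).symm
    · rw [Set.indicator_of_notMem hx]
      obtain ⟨i, hi⟩ : ∃ i, x i ∉ s i := by simpa [Set.mem_pi] using hx
      exact (Finset.prod_eq_zero (Finset.mem_univ i) (Set.indicator_of_notMem hi _)).symm
  simp_rw [this]
  rw [lintegral_fin_prod_eq_prod fun i => (hf i).indicator (hs i)]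
  exact Finset.prod_congr rfl fun i _ => by
    rw [lintegral_indicator (hs i), withDensity_apply _ (hs i)]

end Lebesgue

/-! ### Conditional laws of counts and words -/

section Poisson

variable {V K : Type*} [Fintype V] [Fintype K]

/-- Induction on the index set: the new coordinate is independent of the partial sum, and
independent Poisson variables add their rates. -/
theorem map_sum_pi_poissonMeasure (r : K → NNReal) :
    (Measure.pi fun k => poissonMeasure (r k)).map (fun z => ∑ k, z k) =
      poissonMeasure (∑ k, r k) := by
  classical
  set μ := Measure.pi fun k => poissonMeasure (r k) with hμ
  have hind : iIndepFun (fun k (z : K → ℕ) => z k) μ :=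
    iIndepFun_pi (X := fun _ => id) fun _ => aemeasurable_id
  have hlaw : ∀ s : Finset K, HasLaw (fun z : K → ℕ => ∑ k ∈ s, z k)
      (poissonMeasure (∑ k ∈ s, r k)) μ := by
    intro s
    induction s using Finset.induction_on with
    | empty =>
      refine ⟨by fun_prop, ?_⟩
      have h0 : poissonMeasure 0 = Measure.dirac 0 := by
        refine Measure.ext_of_singleton fun n => ?_
        rw [poissonMeasure_singleton]
        cases n <;> simp
      simp [h0, Measure.map_const]
    | insert k s hk ih =>
      have h1 : HasLaw (fun z : K → ℕ => z k) (poissonMeasure (r k)) μ :=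
        ⟨(measurable_pi_apply k).aemeasurable,
          (measurePreserving_eval (fun k => poissonMeasure (r k)) k).map_eq⟩
      have h2 : IndepFun (fun z : K → ℕ => z k) (fun z : K → ℕ => ∑ k ∈ s, z k) μ := by
        have := (hind.indepFun_finsetSum_of_notMem (fun k => measurable_pi_apply k) hk).symm
        convert this using 1
        ext z
        simp
      have h3 := h2.hasLaw_add_poissonMeasure h1 ih
      rw [Finset.sum_insert hk]
      convert h3 using 1
      ext z
      simp [Finset.sum_insert hk]
  exact (hlaw Finset.univ).map_eq

theorem poissonCountLaw_eq_pi (W : Matrix V K ℝ) (h : K → ℝ) :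
    poissonCountLaw W h =
      Measure.pi fun v => poissonMeasure (∑ k, (W v k * h k).toNNReal) := by
  rw [poissonCountLaw]
  have := Measure.pi_map_pi (μ := fun v => Measure.pi fun k => poissonMeasure (W v k * h k).toNNReal)
    (f := fun _ (z : K → ℕ) => ∑ k, z k) (hf := fun _ => by fun_prop)
  rw [this]
  simp_rw [map_sum_pi_poissonMeasure]

theorem poissonCountLaw_singleton {W : Matrix V K ℝ} (hW : W ∈ normalizedTopics V K) {h : K → ℝ}
    (hh : ∀ k, 0 < h k) (x : V → ℕ) :
    poissonCountLaw W h {x} = ENNReal.ofReal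
      (Real.exp (-∑ k, h k) * (∏ v, (∑ k, h k * W v k) ^ x v) / ∏ v, ((x v).factorial : ℝ)) := by
  have hW0 : ∀ v k, 0 ≤ W v k := fun v k => (hW k).1 v
  have hrate : ∀ v, ((∑ k, (W v k * h k).toNNReal : NNReal) : ℝ) = ∑ k, h k * W v k := by
    intro v
    rw [NNReal.coe_sum]
    exact Finset.sum_congr rfl fun k _ => by
      rw [Real.coe_toNNReal _ (mul_nonneg (hW0 v k) (hh k).le), mul_comm]
  -- The only place where the columns of `W` summing to one is used.
  have htotal : ∑ v, ∑ k, h k * W v k = ∑ k, h k := by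
    rw [Finset.sum_comm]
    exact Finset.sum_congr rfl fun k _ => by
      rw [← Finset.mul_sum, (hW k).2, mul_one]
  rw [poissonCountLaw_eq_pi, Measure.pi_singleton]
  simp_rw [poissonMeasure_singleton, hrate]
  rw [← ENNReal.ofReal_prod_of_nonneg]
  · congr 1
    rw [Finset.prod_div_distrib, Finset.prod_mul_distrib, ← Real.exp_sum, Finset.sum_neg_distrib,
      htotal]
  · intro v _
    have : 0 ≤ ∑ k, h k * W v k :=
      Finset.sum_nonneg fun k _ => mul_nonneg (hh k).le (hW0 v k)
    positivity

theorem poissonCountLaw_le_one (W : Matrix V K ℝ) (h : K → ℝ) (s : Set (V → ℕ)) :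
    poissonCountLaw W h s ≤ 1 := by
  rw [poissonCountLaw_eq_pi]
  exact prob_le_one

/-- Distributivity: the sum over all topic assignments factors word by word. -/
theorem ldaWordProb_eq_prod {V : Type*} {N : ℕ} (W : Matrix V K ℝ) (h : K → ℝ) (ν : Fin N → V) :
    ldaWordProb W h ν = ∏ n, ∑ k, h k * W (ν n) k := by
  classical
  rw [ldaWordProb, Finset.prod_univ_sum]
  simp

theorem ldaWordProb_eq_prod_pow_termCounts {D : Type*} {N : D → ℕ} (W : Matrix V K ℝ) (h : K → ℝ)
    (ν : ∀ d, Fin (N d) → V) (d : D) :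
    ldaWordProb W h (ν d) = ∏ v, (∑ k, h k * W v k) ^ termCounts ν v d := by
  classical
  rw [ldaWordProb_eq_prod, ← Finset.prod_fiberwise (s := Finset.univ) (g := ν d)]
  refine Finset.prod_congr rfl fun v _ => ?_
  rw [Finset.prod_congr rfl (g := fun _ => ∑ k, h k * W v k), Finset.prod_const, termCounts]
  intro n hn
  rw [(Finset.mem_filter.1 hn).2]

end Poisson

/-! ### Gamma and Dirichlet integrals of forms -/

section Gamma

/-- `gammaPDF` may be nonzero at `0` (for `α = 1`). The indicator makes the joint density vanish
exactly off the open orthant, as the radial formula and `dirichletPDFReal` require. -/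
theorem indicator_gammaPDF_ae_eq (α a : ℝ) :
    (Set.Ioi 0).indicator (gammaPDF α a) =ᵐ[volume] gammaPDF α a := by
  filter_upwards [Measure.ae_ne (volume : Measure ℝ) 0] with x hx
  rcases lt_or_gt_of_ne hx with h | h
  · rw [Set.indicator_of_notMem (by simpa using h.le), gammaPDF_of_neg h]
  · rw [Set.indicator_of_mem (Set.mem_Ioi.2 h)]

theorem setLIntegral_Ioi_gammaPDF {α a : ℝ} (hα : 0 < α) (ha : 0 < a) :
    ∫⁻ x in Set.Ioi 0, gammaPDF α a x = 1 := by
  rw [← lintegral_indicator measurableSet_Ioi, lintegral_congr_ae (indicator_gammaPDF_ae_eq α a),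
    lintegral_gammaPDF_eq_one hα ha]

theorem measurable_indicator_gammaPDF (α a : ℝ) :
    Measurable ((Set.Ioi 0).indicator (gammaPDF α a)) :=
  (measurable_gammaPDFReal α a).ennreal_ofReal.indicator measurableSet_Ioi

theorem measurable_prod_indicator_gammaPDF {ι : Type*} [Fintype ι] (α a : ι → ℝ) :
    Measurable fun h : ι → ℝ => ∏ k, (Set.Ioi 0).indicator (gammaPDF (α k) (a k)) (h k) :=
  Finset.measurable_prod _ fun k _ =>
    (measurable_indicator_gammaPDF (α k) (a k)).comp (measurable_pi_apply k)

theorem gammaPrior_eq_withDensity {n : ℕ} {α a : Fin n → ℝ} (hα : ∀ k, 0 < α k)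
    (ha : ∀ k, 0 < a k) :
    gammaPrior α a = (volume : Measure (Fin n → ℝ)).withDensity
      fun h => ∏ k, (Set.Ioi 0).indicator (gammaPDF (α k) (a k)) (h k) := by
  have heq : ∀ k, gammaMeasure (α k) (a k) =
      (volume : Measure ℝ).withDensity ((Set.Ioi 0).indicator (gammaPDF (α k) (a k))) := fun k =>
    (withDensity_congr_ae (indicator_gammaPDF_ae_eq (α k) (a k))).symm
  have : ∀ k, SigmaFinite
      ((volume : Measure ℝ).withDensity ((Set.Ioi 0).indicator (gammaPDF (α k) (a k)))) := by
    intro k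
    rw [← heq k]
    have := isProbabilityMeasure_gammaMeasure (hα k) (ha k)
    infer_instance
  simp_rw [gammaPrior, heq]
  exact pi_withDensity fun k => measurable_indicator_gammaPDF (α k) (a k)

theorem prod_gammaPDF {ι : Type*} [Fintype ι] {α : ι → ℝ} {a : ℝ} (hα : ∀ k, 0 < α k) (ha : 0 < a)
    {h : ι → ℝ} (hh : ∀ k, 0 < h k) :
    ∏ k, (Set.Ioi 0).indicator (gammaPDF (α k) a) (h k) =
      ENNReal.ofReal (a ^ (∑ k, α k) / (∏ k, Real.Gamma (α k)) * (∏ k, h k ^ (α k - 1)) *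
        Real.exp (-(a * ∑ k, h k))) := by
  have hk : ∀ k, (Set.Ioi 0).indicator (gammaPDF (α k) a) (h k) = ENNReal.ofReal
      (a ^ α k / Real.Gamma (α k) * h k ^ (α k - 1) * Real.exp (-(a * h k))) := fun k => by
    rw [Set.indicator_of_mem (Set.mem_Ioi.2 (hh k)), gammaPDF_of_nonneg (hh k).le]
  simp_rw [hk]
  rw [← ENNReal.ofReal_prod_of_nonneg]
  · rw [Finset.prod_mul_distrib, Finset.prod_mul_distrib, Finset.prod_div_distrib, ← Real.exp_sum,
      Finset.sum_neg_distrib, ← Finset.mul_sum, Real.rpow_sum_of_pos ha]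
  · intro k _
    have := Real.Gamma_pos_of_pos (hα k)
    have := Real.rpow_pos_of_pos (hh k) (α k - 1)
    positivity

theorem measurable_dirichletPDFReal {m : ℕ} (α : Fin (m + 1) → ℝ) :
    Measurable (dirichletPDFReal α) := by
  classical
  refine Measurable.ite ?_ (by fun_prop) measurable_const
  have : {h : Fin (m + 1) → ℝ | ∀ k, 0 < h k} = ⋂ k, {h | 0 < h k} := by ext; simp
  rw [this]
  exact MeasurableSet.iInter fun k => measurableSet_lt measurable_const (measurable_pi_apply k)

theorem measurable_ofReal_dirichletPDFReal_simplexChart {m : ℕ} (α : Fin (m + 1) → ℝ) :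
    Measurable fun y => ENNReal.ofReal (dirichletPDFReal α (simplexChart y)) :=
  ((measurable_dirichletPDFReal α).comp measurable_simplexChart).ennreal_ofReal

theorem dirichletPDFReal_of_not_pos {m : ℕ} (α : Fin (m + 1) → ℝ) {h : Fin (m + 1) → ℝ}
    (hh : ¬ ∀ k, 0 < h k) : dirichletPDFReal α h = 0 := by
  rw [dirichletPDFReal, if_neg hh]

theorem lintegral_dirichletMeasure {m : ℕ} (α : Fin (m + 1) → ℝ) {f : (Fin (m + 1) → ℝ) → ℝ≥0∞}
    (hf : Measurable f) :
    ∫⁻ h, f h ∂(dirichletMeasure α) =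
      ∫⁻ y, ENNReal.ofReal (dirichletPDFReal α (simplexChart y)) * f (simplexChart y) := by
  rw [dirichletMeasure, lintegral_map hf measurable_simplexChart,
    lintegral_withDensity_eq_lintegral_mul _
      (measurable_ofReal_dirichletPDFReal_simplexChart α)
      (show Measurable fun y => f (simplexChart y) from hf.comp measurable_simplexChart)]
  rfl

theorem ae_dirichletMeasure {m : ℕ} (α : Fin (m + 1) → ℝ) :
    ∀ᵐ h ∂(dirichletMeasure α), (∀ k, 0 < h k) ∧ ∑ k, h k = 1 := by
  have hset : MeasurableSet {h : Fin (m + 1) → ℝ | (∀ k, 0 < h k) ∧ ∑ k, h k = 1} := by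
    have : {h : Fin (m + 1) → ℝ | (∀ k, 0 < h k) ∧ ∑ k, h k = 1} =
        (⋂ k, {h | 0 < h k}) ∩ {h | ∑ k, h k = 1} := by ext; simp
    rw [this]
    exact (MeasurableSet.iInter fun k =>
      measurableSet_lt measurable_const (measurable_pi_apply k)).inter
        (measurableSet_eq_fun (by fun_prop) measurable_const)
  rw [dirichletMeasure, ae_map_iff measurable_simplexChart.aemeasurable hset,
    ae_withDensity_iff (measurable_ofReal_dirichletPDFReal_simplexChart α)]
  refine Filter.Eventually.of_forall fun y hy => ⟨?_, sum_simplexChart y⟩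
  by_contra hneg
  exact hy (by rw [dirichletPDFReal_of_not_pos α hneg, ENNReal.ofReal_zero])

theorem ae_gammaPrior {n : ℕ} {α a : Fin n → ℝ} (hα : ∀ k, 0 < α k) (ha : ∀ k, 0 < a k) :
    ∀ᵐ h ∂(gammaPrior α a), ∀ k, 0 < h k := by
  rw [gammaPrior_eq_withDensity hα ha, ae_withDensity_iff (measurable_prod_indicator_gammaPDF α a)]
  refine Filter.Eventually.of_forall fun h hh k => ?_
  by_contra hneg
  exact hh (Finset.prod_eq_zero (Finset.mem_univ k) (Set.indicator_of_notMem hneg _))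

/-- The ratio of the Gamma–Poisson to the Dirichlet integral of a form of degree `n`. -/
noncomputable def gammaDirichletRatio (s a : ℝ) (n : ℕ) : ℝ :=
  a ^ s / Real.Gamma s * (Real.Gamma (s + n) / (1 + a) ^ (s + n))

theorem gammaDirichletRatio_pos {s a : ℝ} (hs : 0 < s) (ha : 0 < a) (n : ℕ) :
    0 < gammaDirichletRatio s a n := by
  have := Real.Gamma_pos_of_pos hs
  have := Real.Gamma_pos_of_pos (show 0 < s + n by positivity)
  unfold gammaDirichletRatio
  positivity

/-- The radial factor is an unnormalized gamma density of shape `∑ α_k + n` and rate `1 + a`, the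
`1` coming from `exp(-∑ h_k)`; the ratio collects the normalizing constants. -/
theorem gamma_mul_smul_eq {m : ℕ} {α : Fin (m + 1) → ℝ} {a : ℝ} (hα : ∀ k, 0 < α k)
    (ha : 0 < a) {F : (Fin (m + 1) → ℝ) → ℝ} {n : ℕ} (hF : ∀ (r : ℝ) h, F (r • h) = r ^ n * F h)
    {r : ℝ} (hr : 0 < r) {h : Fin (m + 1) → ℝ} (hh : ∑ k, h k = 1) :
    ENNReal.ofReal (r ^ m) * ((∏ k, (Set.Ioi 0).indicator (gammaPDF (α k) a) ((r • h) k)) *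
        ENNReal.ofReal (Real.exp (-∑ k, (r • h) k) * F (r • h))) =
      ENNReal.ofReal (gammaDirichletRatio (∑ k, α k) a n) *
        gammaPDF (∑ k, α k + n) (1 + a) r *
        (ENNReal.ofReal (dirichletPDFReal α h) * ENNReal.ofReal (F h)) := by
  by_cases hpos : ∀ k, 0 < h k
  · have hpos' : ∀ k, 0 < (r • h) k := fun k => mul_pos hr (hpos k)
    have hs : 0 < ∑ k, α k := Finset.sum_pos (fun k _ => hα k) Finset.univ_nonempty
    have hsum : ∑ k, (r • h) k = r := by
      simp only [Pi.smul_apply, smul_eq_mul, ← Finset.mul_sum, hh, mul_one]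
    have hprod : ∏ k, (r • h) k ^ (α k - 1) =
        r ^ (∑ k, α k - (m + 1)) * ∏ k, h k ^ (α k - 1) := by
      simp only [Pi.smul_apply, smul_eq_mul]
      rw [Finset.prod_congr rfl fun k _ => Real.mul_rpow hr.le (hpos k).le,
        Finset.prod_mul_distrib, ← Real.rpow_sum_of_pos hr]
      simp
    have hΓ := Real.Gamma_pos_of_pos hs
    have hΓn := Real.Gamma_pos_of_pos (show 0 < ∑ k, α k + n by positivity)
    have hΓp : 0 < ∏ k, Real.Gamma (α k) :=
      Finset.prod_pos fun k _ => Real.Gamma_pos_of_pos (hα k)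
    have hP : 0 < ∏ k, h k ^ (α k - 1) :=
      Finset.prod_pos fun k _ => Real.rpow_pos_of_pos (hpos k) _
    have hD : 0 ≤ dirichletPDFReal α h := by
      rw [dirichletPDFReal, if_pos hpos]
      positivity
    have hratio := gammaDirichletRatio_pos hs ha n
    rw [prod_gammaPDF hα ha hpos', hsum, hprod, hF, gammaPDF_of_nonneg hr.le,
      ← ENNReal.ofReal_mul (by positivity), ← ENNReal.ofReal_mul (by positivity),
      ← ENNReal.ofReal_mul hD, ← ENNReal.ofReal_mul hratio.le,
      ← ENNReal.ofReal_mul (by positivity)]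
    congr 1
    rw [dirichletPDFReal, if_pos hpos, gammaDirichletRatio]
    -- The Jacobian `r ^ m` cancels all but one of the `m + 1` shifts in the exponents `α k - 1`.
    have hpow : r ^ (∑ k, α k + n - 1) = r ^ m * r ^ (∑ k, α k - (m + 1)) * r ^ n := by
      rw [← Real.rpow_natCast r m, ← Real.rpow_natCast r n, ← Real.rpow_add hr,
        ← Real.rpow_add hr]
      congr 1
      ring
    have hexp : Real.exp (-((1 + a) * r)) = Real.exp (-(a * r)) * Real.exp (-r) := by
      rw [← Real.exp_add]
      congr 1
      ring
    rw [hpow, hexp]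
    have : (1 + a) ^ (∑ k, α k + n) ≠ 0 := (Real.rpow_pos_of_pos (by positivity) _).ne'
    field_simp
  · rw [dirichletPDFReal_of_not_pos α hpos]
    obtain ⟨k, hk⟩ := not_forall.1 hpos
    rw [Finset.prod_eq_zero (Finset.mem_univ k) (Set.indicator_of_notMem (fun h' =>
      hk (pos_of_mul_pos_right (Set.mem_Ioi.1 h') hr.le)) _)]
    simp

/-- Integrating a form of degree `n` against the gamma prior factors through its integral against
the Dirichlet distribution. -/
theorem lintegral_gammaPrior_eq {m : ℕ} {α : Fin (m + 1) → ℝ} {a : ℝ} (hα : ∀ k, 0 < α k)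
    (ha : 0 < a) {F : (Fin (m + 1) → ℝ) → ℝ} (hFm : Measurable F) {n : ℕ}
    (hF : ∀ (r : ℝ) h, F (r • h) = r ^ n * F h) :
    ∫⁻ h, ENNReal.ofReal (Real.exp (-∑ k, h k) * F h) ∂(gammaPrior α fun _ => a) =
      ENNReal.ofReal (gammaDirichletRatio (∑ k, α k) a n) *
        ∫⁻ h, ENNReal.ofReal (F h) ∂(dirichletMeasure α) := by
  have hs : 0 < ∑ k, α k := Finset.sum_pos (fun k _ => hα k) Finset.univ_nonempty
  have hdens : Measurable fun h : Fin (m + 1) → ℝ =>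
      ∏ k, (Set.Ioi 0).indicator (gammaPDF (α k) a) (h k) :=
    measurable_prod_indicator_gammaPDF α fun _ => a
  have hmeas : Measurable fun h : Fin (m + 1) → ℝ =>
      ENNReal.ofReal (Real.exp (-∑ k, h k) * F h) := by fun_prop
  rw [gammaPrior_eq_withDensity hα fun _ => ha,
    lintegral_withDensity_eq_lintegral_mul _ hdens hmeas,
    lintegral_eq_lintegral_smul_simplexChart (hdens.mul hmeas),
    lintegral_dirichletMeasure α hFm.ennreal_ofReal]
  · have hchart : Measurable fun y : Fin m → ℝ =>
        ENNReal.ofReal (dirichletPDFReal α (simplexChart y)) *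
          ENNReal.ofReal (F (simplexChart y)) :=
      (measurable_ofReal_dirichletPDFReal_simplexChart α).mul
        (hFm.comp measurable_simplexChart).ennreal_ofReal
    have hradial : ∀ r ∈ Set.Ioi (0 : ℝ),
        ENNReal.ofReal (r ^ m) * ∫⁻ y : Fin m → ℝ,
          ((fun h : Fin (m + 1) → ℝ =>
            ∏ k, (Set.Ioi 0).indicator (gammaPDF (α k) a) (h k)) * fun h =>
              ENNReal.ofReal (Real.exp (-∑ k, h k) * F h)) (r • simplexChart y) =
        gammaPDF (∑ k, α k + n) (1 + a) r *
          (ENNReal.ofReal (gammaDirichletRatio (∑ k, α k) a n) *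
            ∫⁻ y : Fin m → ℝ, ENNReal.ofReal (dirichletPDFReal α (simplexChart y)) *
              ENNReal.ofReal (F (simplexChart y))) := by
      intro r hr
      rw [← lintegral_const_mul' _ _ ENNReal.ofReal_ne_top, ← mul_assoc, mul_comm (gammaPDF _ _ _),
        ← lintegral_const_mul _ hchart]
      exact lintegral_congr fun y => gamma_mul_smul_eq hα ha hF hr (sum_simplexChart y)
    -- The radial gamma density has mass one, leaving the constant times the Dirichlet integral.
    rw [setLIntegral_congr_fun measurableSet_Ioi hradial,
      lintegral_mul_const _ (show Measurable (gammaPDF (∑ k, α k + n) (1 + a)) from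
        (measurable_gammaPDFReal _ _).ennreal_ofReal),
      setLIntegral_Ioi_gammaPDF (by positivity) (by positivity), one_mul]
  · intro h hh
    obtain ⟨k, hk⟩ := not_forall.1 hh
    rw [Pi.mul_apply, Finset.prod_eq_zero (Finset.mem_univ k) (Set.indicator_of_notMem hk _),
      zero_mul]

end Gamma

/-! ### Comparison of the three likelihoods -/

section Likelihoods

variable {V D : Type*} [Fintype V] [Fintype D] {m : ℕ}

theorem lintegral_poissonCountLaw_gammaPrior {α : Fin (m + 1) → ℝ} {a : ℝ} (hα : ∀ k, 0 < α k)
    (ha : 0 < a) {W : Matrix V (Fin (m + 1)) ℝ} (hW : W ∈ normalizedTopics V (Fin (m + 1)))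
    (x : V → ℕ) :
    ∫⁻ h, poissonCountLaw W h {x} ∂(gammaPrior α fun _ => a) =
      ENNReal.ofReal (gammaDirichletRatio (∑ k, α k) a (∑ v, x v) / ∏ v, ((x v).factorial : ℝ)) *
        ∫⁻ h, ENNReal.ofReal (∏ v, (∑ k, h k * W v k) ^ x v) ∂(dirichletMeasure α) := by
  have hhom : ∀ (r : ℝ) (h : Fin (m + 1) → ℝ), ∏ v, (∑ k, (r • h) k * W v k) ^ x v =
      r ^ (∑ v, x v) * ∏ v, (∑ k, h k * W v k) ^ x v := by
    intro r h
    simp only [Pi.smul_apply, smul_eq_mul, mul_assoc, ← Finset.mul_sum, mul_pow,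
      Finset.prod_mul_distrib, Finset.prod_pow_eq_pow_sum]
  have hfact : 0 ≤ (∏ v, ((x v).factorial : ℝ))⁻¹ := by positivity
  rw [div_eq_inv_mul, ENNReal.ofReal_mul hfact, mul_assoc,
    ← lintegral_gammaPrior_eq hα ha (by fun_prop) hhom,
    ← lintegral_const_mul' _ _ ENNReal.ofReal_ne_top]
  refine lintegral_congr_ae ?_
  filter_upwards [ae_gammaPrior hα fun _ => ha] with h hh
  rw [poissonCountLaw_singleton hW hh, ← ENNReal.ofReal_mul hfact, div_eq_inv_mul]

theorem lintegral_poissonCountLaw_dirichletMeasure (α : Fin (m + 1) → ℝ)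
    {W : Matrix V (Fin (m + 1)) ℝ} (hW : W ∈ normalizedTopics V (Fin (m + 1))) (x : V → ℕ) :
    ∫⁻ h, poissonCountLaw W h {x} ∂(dirichletMeasure α) =
      ENNReal.ofReal (Real.exp (-1) / ∏ v, ((x v).factorial : ℝ)) *
        ∫⁻ h, ENNReal.ofReal (∏ v, (∑ k, h k * W v k) ^ x v) ∂(dirichletMeasure α) := by
  rw [← lintegral_const_mul' _ _ ENNReal.ofReal_ne_top]
  refine lintegral_congr_ae ?_
  filter_upwards [ae_dirichletMeasure α] with h hh
  rw [poissonCountLaw_singleton hW hh.1, hh.2, ← ENNReal.ofReal_mul (by positivity),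
    div_mul_eq_mul_div]

/-- The ratio of the Gamma–Poisson to the Dirichlet–Poisson likelihood. -/
noncomputable def dirichletPoissonRatio (X : Matrix V D ℕ) (s a : ℝ) : ℝ :=
  ∏ d, Real.exp 1 * gammaDirichletRatio s a (∑ v, X v d)

/-- The ratio of the Gamma–Poisson likelihood to the likelihood of latent Dirichlet allocation. -/
noncomputable def ldaRatio (X : Matrix V D ℕ) (s a : ℝ) : ℝ :=
  ∏ d, gammaDirichletRatio s a (∑ v, X v d) / ∏ v, ((X v d).factorial : ℝ)

theorem dirichletPoissonRatio_pos (X : Matrix V D ℕ) {s a : ℝ} (hs : 0 < s) (ha : 0 < a) :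
    0 < dirichletPoissonRatio X s a :=
  Finset.prod_pos fun _ _ => mul_pos (Real.exp_pos 1) (gammaDirichletRatio_pos hs ha _)

theorem ldaRatio_pos (X : Matrix V D ℕ) {s a : ℝ} (hs : 0 < s) (ha : 0 < a) :
    0 < ldaRatio X s a :=
  Finset.prod_pos fun _ _ => div_pos (gammaDirichletRatio_pos hs ha _) (by positivity)

theorem gammaPoissonLikelihood_ne_top {α : Fin (m + 1) → ℝ} {a : ℝ} (hα : ∀ k, 0 < α k)
    (ha : 0 < a) (X : Matrix V D ℕ) (W : Matrix V (Fin (m + 1)) ℝ) :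
    gammaPoissonLikelihood X α (fun _ => a) W ≠ ∞ := by
  have := fun k => isProbabilityMeasure_gammaMeasure (hα k) ha
  have : IsProbabilityMeasure (gammaPrior α fun _ => a) := by
    unfold gammaPrior
    infer_instance
  refine ENNReal.prod_ne_top fun d _ => ne_top_of_le_ne_top ENNReal.one_ne_top ?_
  calc ∫⁻ h, poissonCountLaw W h {fun v => X v d} ∂(gammaPrior α fun _ => a)
      ≤ ∫⁻ _, 1 ∂(gammaPrior α fun _ => a) :=
        lintegral_mono fun h => poissonCountLaw_le_one W h _
    _ = 1 := by simp

theorem gammaPoissonLikelihood_eq_dirichletPoissonLikelihood {α : Fin (m + 1) → ℝ} {a : ℝ}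
    (hα : ∀ k, 0 < α k) (ha : 0 < a) (X : Matrix V D ℕ) {W : Matrix V (Fin (m + 1)) ℝ}
    (hW : W ∈ normalizedTopics V (Fin (m + 1))) :
    gammaPoissonLikelihood X α (fun _ => a) W =
      ENNReal.ofReal (dirichletPoissonRatio X (∑ k, α k) a) *
        dirichletPoissonLikelihood X α W := by
  have hs : 0 < ∑ k, α k := Finset.sum_pos (fun k _ => hα k) Finset.univ_nonempty
  have hpos : ∀ d, 0 < Real.exp 1 * gammaDirichletRatio (∑ k, α k) a (∑ v, X v d) := fun d =>
    mul_pos (Real.exp_pos 1) (gammaDirichletRatio_pos hs ha _)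
  rw [gammaPoissonLikelihood, dirichletPoissonLikelihood, dirichletPoissonRatio,
    ENNReal.ofReal_prod_of_nonneg fun d _ => (hpos d).le, ← Finset.prod_mul_distrib]
  refine Finset.prod_congr rfl fun d _ => ?_
  rw [lintegral_poissonCountLaw_gammaPrior hα ha hW,
    lintegral_poissonCountLaw_dirichletMeasure α hW, ← mul_assoc,
    ← ENNReal.ofReal_mul (hpos d).le]
  -- The factorials occur on both sides and cancel; only `e` per document remains beside the gamma
  -- ratio.
  congr 2
  rw [Real.exp_neg]
  field_simp

/-- LDA gives the probability of an ordered word sequence, without factorials, so they stay in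
`ldaRatio`. -/
theorem gammaPoissonLikelihood_eq_ldaLikelihood {α : Fin (m + 1) → ℝ} {a : ℝ}
    (hα : ∀ k, 0 < α k) (ha : 0 < a) {N : D → ℕ} (ν : ∀ d, Fin (N d) → V)
    {W : Matrix V (Fin (m + 1)) ℝ} (hW : W ∈ normalizedTopics V (Fin (m + 1))) :
    gammaPoissonLikelihood (termCounts ν) α (fun _ => a) W =
      ENNReal.ofReal (ldaRatio (termCounts ν) (∑ k, α k) a) * ldaLikelihood ν α W := by
  have hs : 0 < ∑ k, α k := Finset.sum_pos (fun k _ => hα k) Finset.univ_nonempty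
  rw [gammaPoissonLikelihood, ldaLikelihood, ldaRatio, ENNReal.ofReal_prod_of_nonneg fun d _ =>
    (div_pos (gammaDirichletRatio_pos hs ha _) (by positivity)).le, ← Finset.prod_mul_distrib]
  refine Finset.prod_congr rfl fun d _ => ?_
  rw [lintegral_poissonCountLaw_gammaPrior hα ha hW]
  simp_rw [ldaWordProb_eq_prod_pow_termCounts]

theorem optimalTopics_eq_of_eq_mul {K : Type*} {L L' : Matrix V K ℝ → ℝ≥0∞} {c : ℝ} (hc : 0 < c)
    (hL : ∀ W ∈ normalizedTopics V K, L W = ENNReal.ofReal c * L' W) :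
    optimalTopics L = optimalTopics L' := by
  ext W
  refine and_congr_right fun hW => forall₂_congr fun W' hW' => ?_
  change L W' ≤ L W ↔ L' W' ≤ L' W
  rw [hL W hW, hL W' hW']
  exact ENNReal.mul_le_mul_iff_right (ENNReal.ofReal_pos.2 hc).ne' ENNReal.ofReal_ne_top

theorem ne_top_of_eq_ofReal_mul {c : ℝ} (hc : 0 < c) {x y : ℝ≥0∞} (hx : x ≠ ∞)
    (h : x = ENNReal.ofReal c * y) : y ≠ ∞ := by
  rintro rfl
  exact hx (h.trans (ENNReal.mul_top (ENNReal.ofReal_pos.2 hc).ne'))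

end Likelihoods

end TopicModel

theorem mainTheorem11 {V D : Type*} [Fintype V] [Fintype D] :
    ∃ cDP cLDA : Matrix V D ℕ → ℝ → ℝ → ℝ,
      (∀ (X : Matrix V D ℕ) (s a : ℝ), 0 < s → 0 < a → 0 < cDP X s a ∧ 0 < cLDA X s a) ∧
      ∀ (m : ℕ) (α : Fin (m + 1) → ℝ) (a : ℝ), (∀ k, 0 < α k) → 0 < a →
        -- the Gamma–Poisson and the Dirichlet–Poisson model
        (∀ X : Matrix V D ℕ,
          (∀ W ∈ TopicModel.normalizedTopics V (Fin (m + 1)),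
            TopicModel.gammaPoissonLikelihood X α (fun _ => a) W ≠ ∞ ∧
            TopicModel.dirichletPoissonLikelihood X α W ≠ ∞ ∧
            TopicModel.gammaPoissonLikelihood X α (fun _ => a) W =
              ENNReal.ofReal (cDP X (∑ k, α k) a) *
                TopicModel.dirichletPoissonLikelihood X α W) ∧
          TopicModel.optimalTopics (TopicModel.gammaPoissonLikelihood X α (fun _ => a)) =
            TopicModel.optimalTopics (TopicModel.dirichletPoissonLikelihood X α)) ∧
        -- the Gamma–Poisson model and latent Dirichlet allocation
        (∀ (N : D → ℕ) (ν : ∀ d, Fin (N d) → V),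
          (∀ W ∈ TopicModel.normalizedTopics V (Fin (m + 1)),
            TopicModel.ldaLikelihood ν α W ≠ ∞ ∧
            TopicModel.gammaPoissonLikelihood (TopicModel.termCounts ν) α (fun _ => a) W =
              ENNReal.ofReal (cLDA (TopicModel.termCounts ν) (∑ k, α k) a) *
                TopicModel.ldaLikelihood ν α W) ∧
          TopicModel.optimalTopics
              (TopicModel.gammaPoissonLikelihood (TopicModel.termCounts ν) α (fun _ => a)) =
            TopicModel.optimalTopics (TopicModel.ldaLikelihood ν α)) := by
  refine ⟨TopicModel.dirichletPoissonRatio, TopicModel.ldaRatio, fun X s a hs ha =>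
    ⟨TopicModel.dirichletPoissonRatio_pos X hs ha, TopicModel.ldaRatio_pos X hs ha⟩,
    fun m α a hα ha => ?_⟩
  have hs : 0 < ∑ k, α k := Finset.sum_pos (fun k _ => hα k) Finset.univ_nonempty
  refine ⟨fun X => ?_, fun N ν => ?_⟩
  · have hc := TopicModel.dirichletPoissonRatio_pos X hs ha
    have heq := fun W hW =>
      TopicModel.gammaPoissonLikelihood_eq_dirichletPoissonLikelihood hα ha X (W := W) hW
    have hfin := TopicModel.gammaPoissonLikelihood_ne_top hα ha X
    exact ⟨fun W hW => ⟨hfin W, TopicModel.ne_top_of_eq_ofReal_mul hc (hfin W) (heq W hW),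
      heq W hW⟩, TopicModel.optimalTopics_eq_of_eq_mul hc heq⟩
  · have hc := TopicModel.ldaRatio_pos (TopicModel.termCounts ν) hs ha
    have heq := fun W hW =>
      TopicModel.gammaPoissonLikelihood_eq_ldaLikelihood hα ha ν (W := W) hW
    have hfin := TopicModel.gammaPoissonLikelihood_ne_top hα ha (TopicModel.termCounts ν)
    exact ⟨fun W hW => ⟨TopicModel.ne_top_of_eq_ofReal_mul hc (hfin W) (heq W hW), heq W hW⟩,
      TopicModel.optimalTopics_eq_of_eq_mul hc heq⟩
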